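/- Let $A\in\mathbb R^{n\times n}$, $B\in\mathbb R^{n\times m}$ with $(A,B)$ controllable, i.e. $\operatorname{rank}[B,AB,\dots,A^{n-1}B]=n$, let $Q\in\mathbb R^{n\times n}$ be symmetric positive semidefinite and $R\in\mathbb R^{m\times m}$ symmetric positive definite. Let $X_0,w^0,w^1,\dots$ be i.i.d. zero-mean Gaussian random vectors in $\mathbb R^n$ (the covariance may be degenerate), and let $$X_{t+1}=AX_t+Bu^t+w^t,\qquad J_T=\frac1T\,\mathbb E\Big[\sum_{t=0}^{T-1}X_t^{\top}QX_t+(u^t)^{\top}Ru^t\Big],\qquad J=\limsup_{T\to\infty}J_T ,$$ with expectations in $[0,\infty]$. Consider the fully observed team with classical information structure, in which $u^t$ is a Borel function of $(X_0,\dots,X_t)$. Put $\zeta^0=X_0$, $\zeta^{k}=w^{k-1}$ for $k\ge1$, and $v_t=\sum_{k=0}^{t}A^{t-k}\zeta^k$ (the uncontrolled part of $X_t$). The static reduction of this team (Ho--Chu) is the team with the same costs in which decision maker $t$ uses an action $u^t=\gamma^t(v^t)$, where $v^t=(v_0,\dots,v_t)$ and $\gamma^t$ is Borel; its policies are $\underline\gamma=(\gamma^0,\gamma^1,\dots)$,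 with costs $J_T(\underline\gamma)$ and $J(\underline\gamma)$. A policy is optimal for a cost if its cost equals the infimum over all such policies. For a dynamic policy $u^t=g^t(X_0,\dots,X_t)$, its static reduction is the static policy obtained by writing, through the dynamics, the actions as functions of $v^t$, so that it generates the same actions. For $T\in\mathbb N$ let $k_T^T=0$ and, for $0\le t<T$, $$k_T^t=Q+A^{\top}k_T^{t+1}A-A^{\top}k_T^{t+1}B(R+B^{\top}k_T^{t+1}B)^{-1}B^{\top}k_T^{t+1}A,\qquad G_T^t=-(R+B^{\top}k_T^{t+1}B)^{-1}B^{\top}k_T^{t+1}A .$$ Then: 1. There is a positive semidefinite matrix $K$ with $\lim_{T\to\infty}k_T^t=K$ for every $t$. It satisfies $K=Q+A^{\top}KA-A^{\top}KB(R+B^{\top}KB)^{-1}B^{\top}KA$, and $\lim_{T\to\infty}G_T^t=G_\infty:=-(R+B^{\top}KB)^{-1}B^{\top}KA$ for every $t$. 2. For every $T$, the static reduction $\underline\gamma_T^*$ of the feedback $u^t=G_T^tX_t$ $(0\le t<T)$ is optimal for $J_T(\underline\gamma)$. For every $t$, $\gamma_T^{t*}$ converges pointwise, as $T\to\infty$,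 to $\gamma_\infty^{t*}$, where $\underline\gamma_\infty^*$ is the static reduction of $u^t=G_\infty X_t$; under $\underline\gamma_\infty^*$ one has $u^t=G_\infty X_t$ for all $t$. 3. $\underline\gamma_\infty^*$ is optimal for the average cost $J(\underline\gamma)$, with $J(\underline\gamma_\infty^*)<\infty$; and the feedback $u^t=G_\infty X_t$ is average-cost optimal among all policies $u^t=g^t(X_0,\dots,X_t)$, $g^t$ Borel, of the original dynamic team. 4. If $(\underline\gamma_T)_T$ is any sequence such that $\underline\gamma_T$ is optimal for $J_T(\underline\gamma)$ for every $T$, then almost surely $\lim_{T\to\infty}\gamma_T^t(v^t)=\gamma_\infty^{t*}(v^t)$ for all $t$, and every policy $\underline\gamma$ with $\gamma_T^t(v^t)\to\gamma^t(v^t)$ almost surely for all $t$ is optimal for $J(\underline\gamma)$. -/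

import Mathlib

open MeasureTheory ProbabilityTheory Filter Topology Matrix
open scoped ENNReal

/-- The data of a linear-quadratic control problem: dynamics `X_{t+1} = A X_t + B u^t + w^t` and
stage cost `X_tᵀ Q X_t + (u^t)ᵀ R u^t`. -/
structure LQSystem (n m : ℕ) where
  A : Matrix (Fin n) (Fin n) ℝ
  B : Matrix (Fin n) (Fin m) ℝ
  Q : Matrix (Fin n) (Fin n) ℝ
  R : Matrix (Fin m) (Fin m) ℝ

/-- A policy: decision maker `t` maps a history of `t + 1` vectors of `ℝⁿ` to an action in `ℝᵐ`.
For the dynamic team the history is `(X_0, …, X_t)`; for the static team it is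
`(v_0, …, v_t)`, where `v_s` is the uncontrolled part of `X_s`. -/
abbrev TeamPolicy (n m : ℕ) : Type :=
  (t : ℕ) → (Fin (t + 1) → Fin n → ℝ) → (Fin m → ℝ)

/-- The set of admissible policies: every decision maker uses a (Borel) measurable function. -/
def admissiblePolicies (n m : ℕ) : Set (TeamPolicy n m) :=
  {γ | ∀ t, Measurable (γ t)}

namespace LQSystem

variable {n m : ℕ} (S : LQSystem n m)

/-- The matrix `[B, AB, …, A^{n-1}B]`. -/
def controllabilityMatrix : Matrix (Fin n) (Fin n × Fin m) ℝ :=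
  Matrix.of fun i p => (S.A ^ (p.1 : ℕ) * S.B) i p.2

/-- `(A, B)` is controllable. -/
def Controllable : Prop := S.controllabilityMatrix.rank = n

/-! ### Dynamics. The primitive noise is `z = (X_0, w^0, w^1, …)`. -/

/-- The state `X_t` generated by the action sequence `u` and the noise `z`. -/
def state (z : ℕ → Fin n → ℝ) (u : ℕ → Fin m → ℝ) : ℕ → Fin n → ℝ
  | 0 => z 0
  | t + 1 => S.A *ᵥ state z u t + S.B *ᵥ u t + z (t + 1)

/-- The uncontrolled state `∑_{k=0}^t A^{t-k} z_k`. -/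
def freeState (z : ℕ → Fin n → ℝ) (t : ℕ) : Fin n → ℝ :=
  ∑ k ∈ Finset.range (t + 1), (S.A ^ (t - k)) *ᵥ z k

/-- The static information `v^t` of decision maker `t`: the uncontrolled observations up to
time `t`, a linear function of the noise that does not depend on any action. -/
def staticInfo (z : ℕ → Fin n → ℝ) (t : ℕ) : Fin (t + 1) → Fin n → ℝ :=
  fun s => S.freeState z s

/-- Actions in the static team: `u^t = γ^t(v^t)`. -/
def staticActions (γ : TeamPolicy n m) (z : ℕ → Fin n → ℝ) : ℕ → Fin m → ℝ :=
  fun t => γ t (S.staticInfo z t)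

/-- The observed history `(X_0, …, X_t)` in the dynamic team, in which `u^t = g^t(X_0, …, X_t)`. -/
def history (g : TeamPolicy n m) (z : ℕ → Fin n → ℝ) : (t : ℕ) → Fin (t + 1) → Fin n → ℝ
  | 0 => fun _ => z 0
  | t + 1 => Fin.snoc (α := fun _ => Fin n → ℝ) (history g z t)
      (S.A *ᵥ history g z t (Fin.last t) + S.B *ᵥ g t (history g z t) + z (t + 1))

/-- Actions in the dynamic team: `u^t = g^t(X_0, …, X_t)`. -/
def dynamicActions (g : TeamPolicy n m) (z : ℕ → Fin n → ℝ) : ℕ → Fin m → ℝ :=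
  fun t => g t (S.history g z t)

/-- The noise recovered from uncontrolled states:
`z_0 = v_0`, `z_{k+1} = v_{k+1} - A v_k` for `k < t` (and `0` beyond the horizon). -/
def noiseOf {t : ℕ} (v : Fin (t + 1) → Fin n → ℝ) : ℕ → Fin n → ℝ
  | 0 => v 0
  | k + 1 => if h : k + 1 < t + 1 then
      v ⟨k + 1, h⟩ - S.A *ᵥ v ⟨k, Nat.lt_of_succ_lt h⟩ else 0

/-- The static reduction of a dynamic policy: the policy on the static information `v^t` that
produces the same actions (see `staticActions_staticReduction`). -/
def staticReduction (g : TeamPolicy n m) : TeamPolicy n m :=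
  fun t v => g t (S.history g (S.noiseOf v) t)

/-- The dynamic policy `u^t = G^t X_t`. -/
def linearFeedback (G : ℕ → Matrix (Fin m) (Fin n) ℝ) : TeamPolicy n m :=
  fun t x => G t *ᵥ x (Fin.last t)

/-! ### Costs. -/

/-- `∑_{t<T} X_tᵀ Q X_t + (u^t)ᵀ R u^t`. -/
def pathCost (T : ℕ) (z : ℕ → Fin n → ℝ) (u : ℕ → Fin m → ℝ) : ℝ :=
  ∑ t ∈ Finset.range T,
    (S.state z u t ⬝ᵥ (S.Q *ᵥ S.state z u t) + u t ⬝ᵥ (S.R *ᵥ u t))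

variable {Ω : Type*} [MeasurableSpace Ω]

/-- `(1/T) E[∑_{t<T} X_tᵀ Q X_t + (u^t)ᵀ R u^t]` for the random noise `ζ`, where the actions are
obtained from the noise by `act`. The cost is nonnegative when `Q ≥ 0` and `R ≥ 0`, and its
expectation is taken in `[0, ∞]`. -/
noncomputable def expectedCost (P : Measure Ω) (ζ : ℕ → Ω → Fin n → ℝ) (T : ℕ)
    (act : (ℕ → Fin n → ℝ) → ℕ → Fin m → ℝ) : ℝ≥0∞ :=
  (∫⁻ ω, ENNReal.ofReal (S.pathCost T (fun k => ζ k ω) (act fun k => ζ k ω)) ∂P) / (T : ℝ≥0∞)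

/-- `J_T(γ)` in the static team. -/
noncomputable def staticJ (P : Measure Ω) (ζ : ℕ → Ω → Fin n → ℝ) (T : ℕ)
    (γ : TeamPolicy n m) : ℝ≥0∞ :=
  S.expectedCost P ζ T (S.staticActions γ)

/-- `J(γ) = limsup_T J_T(γ)` in the static team. -/
noncomputable def staticAvgJ (P : Measure Ω) (ζ : ℕ → Ω → Fin n → ℝ)
    (γ : TeamPolicy n m) : ℝ≥0∞ :=
  limsup (fun T => S.staticJ P ζ T γ) atTop

/-- The average cost of a dynamic policy. -/
noncomputable def dynamicAvgJ (P : Measure Ω) (ζ : ℕ → Ω → Fin n → ℝ)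
    (g : TeamPolicy n m) : ℝ≥0∞ :=
  limsup (fun T => S.expectedCost P ζ T (S.dynamicActions g)) atTop

/-! ### Riccati recursion. -/

/-- `K ↦ Q + AᵀKA - AᵀKB (R + BᵀKB)⁻¹ BᵀKA`. -/
noncomputable def riccatiStep (K : Matrix (Fin n) (Fin n) ℝ) : Matrix (Fin n) (Fin n) ℝ :=
  S.Q + S.Aᵀ * K * S.A
    - S.Aᵀ * K * S.B * (S.R + S.Bᵀ * K * S.B)⁻¹ * S.Bᵀ * K * S.A

/-- `K ↦ -(R + BᵀKB)⁻¹ BᵀKA`. -/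
noncomputable def gain (K : Matrix (Fin n) (Fin n) ℝ) : Matrix (Fin m) (Fin n) ℝ :=
  -((S.R + S.Bᵀ * K * S.B)⁻¹ * S.Bᵀ * K * S.A)

/-- `k_T^t` for `t ≤ T`: the solution of the backward Riccati recursion from `k_T^T = 0`. -/
noncomputable def riccatiK (T t : ℕ) : Matrix (Fin n) (Fin n) ℝ :=
  S.riccatiStep^[T - t] 0

/-- `G_T^t` for `t < T`. -/
noncomputable def finiteGain (T t : ℕ) : Matrix (Fin m) (Fin n) ℝ :=
  S.gain (S.riccatiK T (t + 1))

/-! ### Sanity facts. -/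

theorem riccatiK_self (T : ℕ) : S.riccatiK T T = 0 := by
  simp [riccatiK]

theorem riccatiK_eq {T t : ℕ} (h : t < T) :
    S.riccatiK T t = S.riccatiStep (S.riccatiK T (t + 1)) := by
  have e : T - t = (T - (t + 1)) + 1 := by omega
  rw [riccatiK, riccatiK, e, Function.iterate_succ_apply']

theorem freeState_succ (z : ℕ → Fin n → ℝ) (t : ℕ) :
    S.freeState z (t + 1) = S.A *ᵥ S.freeState z t + z (t + 1) := by
  unfold freeState
  rw [Finset.sum_range_succ, Matrix.mulVec_sum]
  congr 1
  · refine Finset.sum_congr rfl fun k hk => ?_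
    have hk' : k < t + 1 := Finset.mem_range.1 hk
    have e : t + 1 - k = (t - k) + 1 := by omega
    rw [e, pow_succ', Matrix.mulVec_mulVec]
  · simp

/-- `X_t = ∑_{j<t} A^{t-1-j} B u^j + v_t`, so `v_t` is `X_t` minus a function of past actions. -/
theorem state_eq (z : ℕ → Fin n → ℝ) (u : ℕ → Fin m → ℝ) (t : ℕ) :
    S.state z u t
      = ∑ j ∈ Finset.range t, (S.A ^ (t - 1 - j) * S.B) *ᵥ u j + S.freeState z t := by
  induction t with
  | zero => simp [state, freeState]
  | succ t ih =>
    rw [state, ih, freeState_succ, Finset.sum_range_succ, Matrix.mulVec_add, Matrix.mulVec_sum]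
    have : ∀ j ∈ Finset.range t, S.A *ᵥ ((S.A ^ (t - 1 - j) * S.B) *ᵥ u j)
        = (S.A ^ (t + 1 - 1 - j) * S.B) *ᵥ u j := by
      intro j hj
      have hj' : j < t := Finset.mem_range.1 hj
      have e : t + 1 - 1 - j = (t - 1 - j) + 1 := by omega
      rw [e, pow_succ', Matrix.mulVec_mulVec, Matrix.mul_assoc]
    rw [Finset.sum_congr rfl this]
    simp
    abel

theorem history_last (g : TeamPolicy n m) (z : ℕ → Fin n → ℝ) (t : ℕ) :
    S.history g z t (Fin.last t) = S.state z (S.dynamicActions g z) t := by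
  induction t with
  | zero => rfl
  | succ t ih => simp [history, state, ih, dynamicActions]

theorem history_congr (g : TeamPolicy n m) {z z' : ℕ → Fin n → ℝ} (t : ℕ)
    (h : ∀ k ≤ t, z k = z' k) : S.history g z t = S.history g z' t := by
  induction t with
  | zero => simp [history, h 0 le_rfl]
  | succ t ih =>
    simp only [history]
    rw [ih fun k hk => h k (by omega), h (t + 1) le_rfl]

theorem noiseOf_staticInfo (z : ℕ → Fin n → ℝ) (t k : ℕ) (h : k ≤ t) :
    S.noiseOf (S.staticInfo z t) k = z k := by
  cases k with
  | zero => simp [noiseOf, staticInfo, freeState]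
  | succ k =>
    have h' : k + 1 < t + 1 := by omega
    simp [noiseOf, h', staticInfo, freeState_succ]

/-- A dynamic policy and its static reduction generate the same actions. -/
theorem staticActions_staticReduction (g : TeamPolicy n m) (z : ℕ → Fin n → ℝ) :
    S.staticActions (S.staticReduction g) z = S.dynamicActions g z := by
  funext t
  simp only [staticActions, staticReduction, dynamicActions]
  rw [S.history_congr g t fun k hk => S.noiseOf_staticInfo z t k hk]

end LQSystem

/-- `γ` is an optimal element of the policy set `Γ` for the cost `J`. -/
def IsTeamOptimal {α : Type*} (Γ : Set α) (J : α → ℝ≥0∞) (γ : α) : Prop :=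
  γ ∈ Γ ∧ J γ = ⨅ γ' ∈ Γ, J γ'

/-! ### Quadratic forms of real matrices. -/

namespace Matrix

/-! Everything rests on completing the square (`stageCost_add_eq`, summed in
`pathCost_add_terminal`). For any solution k_t of the Riccati recursion, path cost plus terminal
term is a sum of squares of u^t - G^t X_t in the positive definite weights R + BᵀkB, plus noise
terms. For adapted square integrable actions the cross terms have mean zero, since fresh noise is
independent of the past; the mean noise terms do not depend on the actions
(`integral_pathCost_add_terminal`). Finite cost forces square integrability because R is positive
definite, so no policy is lost.

With k_t = k_T^t the terminal term vanishes: the feedback G_T^t attains the finite-horizon value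
V_T, and any other optimal policy obeys the same law almost surely.

The iterates of the Riccati map from 0 are values of noiseless problems. They increase with the
horizon and are bounded because controllability allows steering to the origin in n steps; hence they
converge to a fixed point K.

For the average cost, let e = E[ζ_0ᵀKζ_0]. Every policy costs at least limsup V_T/T = e, by Cesàro.
The same identity with constant k_t = K bounds the T-stage cost of G_∞ by (T+1)e, on dropping a
nonnegative terminal term. No stability of the closed loop is needed. -/

theorem PosSemidef.quadForm_nonneg {ι : Type*} [Fintype ι] {M : Matrix ι ι ℝ}
    (hM : M.PosSemidef) (x : ι → ℝ) : 0 ≤ x ⬝ᵥ (M *ᵥ x) := by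
  simpa using hM.dotProduct_mulVec_nonneg x

theorem PosDef.quadForm_pos {ι : Type*} [Fintype ι] {M : Matrix ι ι ℝ}
    (hM : M.PosDef) {x : ι → ℝ} (hx : x ≠ 0) : 0 < x ⬝ᵥ (M *ᵥ x) := by
  simpa using hM.dotProduct_mulVec_pos hx

theorem PosSemidef.transpose_eq {ι : Type*} {M : Matrix ι ι ℝ}
    (hM : M.PosSemidef) : Mᵀ = M := by
  simpa using hM.isHermitian.eq

theorem dotProduct_mulVec_comm_of_transpose_eq {ι : Type*} [Fintype ι] {M : Matrix ι ι ℝ}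
    (hM : Mᵀ = M) (x y : ι → ℝ) : x ⬝ᵥ (M *ᵥ y) = y ⬝ᵥ (M *ᵥ x) := by
  rw [dotProduct_mulVec, ← mulVec_transpose, hM, dotProduct_comm]

theorem quadForm_add_of_transpose_eq {ι : Type*} [Fintype ι] {M : Matrix ι ι ℝ}
    (hM : Mᵀ = M) (x y : ι → ℝ) :
    (x + y) ⬝ᵥ (M *ᵥ (x + y)) = x ⬝ᵥ (M *ᵥ x) + 2 * (y ⬝ᵥ (M *ᵥ x)) + y ⬝ᵥ (M *ᵥ y) := by
  rw [mulVec_add, add_dotProduct, dotProduct_add, dotProduct_add,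
    dotProduct_mulVec_comm_of_transpose_eq hM x y]
  ring

/-- A positive definite quadratic form controls each coordinate. -/
theorem PosDef.sq_apply_le {ι : Type*} [Fintype ι] [DecidableEq ι] {M : Matrix ι ι ℝ}
    (hM : M.PosDef) (u : ι → ℝ) (i : ι) : u i ^ 2 ≤ M⁻¹ i i * (u ⬝ᵥ (M *ᵥ u)) := by
  have hp : 0 < M⁻¹ i i := hM.inv.diag_pos
  set y : ι → ℝ := M⁻¹ *ᵥ Pi.single i 1 with hy
  have hMy : M *ᵥ y = Pi.single i 1 := by
    rw [hy, mulVec_mulVec, mul_nonsing_inv _ ((isUnit_iff_isUnit_det _).1 hM.isUnit), one_mulVec]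
  have hyi : y i = M⁻¹ i i := by simp [hy]
  -- The minimizer of s ↦ s² M⁻¹ i i + 2 s u i + uᵀMu, the quadratic form at s • y + u.
  set s : ℝ := -(u i / M⁻¹ i i) with hs
  have h := hM.posSemidef.quadForm_nonneg (s • y + u)
  rw [quadForm_add_of_transpose_eq hM.posSemidef.transpose_eq, mulVec_smul, hMy] at h
  simp only [dotProduct_smul, smul_eq_mul, dotProduct_single, mul_one, Pi.smul_apply, hyi] at h
  have e : s * (s * M⁻¹ i i) + 2 * (s * u i) = - (u i ^ 2 / M⁻¹ i i) := by
    rw [hs]; field_simp; ring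
  rw [e] at h
  have h2 : u i ^ 2 / M⁻¹ i i ≤ u ⬝ᵥ (M *ᵥ u) := by linarith
  rwa [div_le_iff₀' hp] at h2

/-- Polarization for the entries of a symmetric matrix. -/
theorem apply_eq_quadForm_of_transpose_eq {ι : Type*} [Fintype ι] [DecidableEq ι]
    {M : Matrix ι ι ℝ} (hM : Mᵀ = M) (i j : ι) :
    M i j = ((Pi.single i 1 + Pi.single j 1) ⬝ᵥ (M *ᵥ (Pi.single i 1 + Pi.single j 1))
      - Pi.single i 1 ⬝ᵥ (M *ᵥ Pi.single i 1) - Pi.single j 1 ⬝ᵥ (M *ᵥ Pi.single j 1)) / 2 := by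
  rw [quadForm_add_of_transpose_eq hM]
  have : M j i = M i j := congrFun (congrFun hM i) j
  simp [this]
  ring

end Matrix

namespace LQSystem

/-! ### The stage identity and the Riccati operator. -/

theorem posDef_inputWeight {n m : ℕ} (S : LQSystem n m) (hR : S.R.PosDef)
    {k : Matrix (Fin n) (Fin n) ℝ} (hk : k.PosSemidef) : (S.R + S.Bᵀ * k * S.B).PosDef := by
  refine hR.add_posSemidef ?_
  simpa using hk.conjTranspose_mul_mul_same S.B

/-- Completion of squares for one stage of the control problem. -/
theorem stageCost_add_eq {n m : ℕ} (S : LQSystem n m) (hR : S.R.PosDef)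
    {k : Matrix (Fin n) (Fin n) ℝ} (hk : k.PosSemidef) (x : Fin n → ℝ) (u : Fin m → ℝ) :
    x ⬝ᵥ (S.Q *ᵥ x) + u ⬝ᵥ (S.R *ᵥ u)
        + (S.A *ᵥ x + S.B *ᵥ u) ⬝ᵥ (k *ᵥ (S.A *ᵥ x + S.B *ᵥ u))
      = x ⬝ᵥ (S.riccatiStep k *ᵥ x)
        + (u - S.gain k *ᵥ x) ⬝ᵥ ((S.R + S.Bᵀ * k * S.B) *ᵥ (u - S.gain k *ᵥ x)) := by
  have hM := S.posDef_inputWeight hR hk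
  have hdet := (isUnit_iff_isUnit_det _).1 hM.isUnit
  have hMt := hM.posSemidef.transpose_eq
  have hkt := hk.transpose_eq
  set M := S.R + S.Bᵀ * k * S.B with hMdef
  set a := S.A *ᵥ x with ha
  -- Minus the minimizing action. It solves M h = Bᵀka, so uᵀMh is the cross term of Bu and a, and
  -- the Riccati step subtracts exactly hᵀMh.
  set h := -(S.gain k *ᵥ x) with hh
  have hMh : M *ᵥ h = S.Bᵀ *ᵥ (k *ᵥ a) := by
    rw [hh, gain, neg_mulVec, neg_neg, mulVec_mulVec, ← hMdef]
    simp only [← Matrix.mul_assoc]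
    rw [mul_nonsing_inv _ hdet, Matrix.one_mul, ha]
    simp only [mulVec_mulVec, Matrix.mul_assoc]
  have hBd : ∀ (w : Fin m → ℝ) (y : Fin n → ℝ), w ⬝ᵥ (S.Bᵀ *ᵥ y) = (S.B *ᵥ w) ⬝ᵥ y := by
    intro w y; rw [dotProduct_mulVec, vecMul_transpose]
  have hAd : ∀ (w : Fin n → ℝ) (y : Fin n → ℝ), w ⬝ᵥ (S.Aᵀ *ᵥ y) = (S.A *ᵥ w) ⬝ᵥ y := by
    intro w y; rw [dotProduct_mulVec, vecMul_transpose]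
  have hstep : x ⬝ᵥ (S.riccatiStep k *ᵥ x)
      = x ⬝ᵥ (S.Q *ᵥ x) + a ⬝ᵥ (k *ᵥ a) - h ⬝ᵥ (M *ᵥ h) := by
    have e1 : S.riccatiStep k *ᵥ x
        = S.Q *ᵥ x + S.Aᵀ *ᵥ (k *ᵥ a) - S.Aᵀ *ᵥ (k *ᵥ (S.B *ᵥ h)) := by
      rw [riccatiStep, hh, gain, ha, neg_mulVec, neg_neg, sub_mulVec, add_mulVec]
      simp only [mulVec_mulVec, Matrix.mul_assoc]
    rw [e1, dotProduct_sub, dotProduct_add, hAd, hAd, hMh, hBd, ← ha,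
      dotProduct_mulVec_comm_of_transpose_eq hkt a (S.B *ᵥ h)]
  have hu : u - S.gain k *ᵥ x = h + u := by rw [hh]; abel
  have hMu : u ⬝ᵥ (M *ᵥ u) = u ⬝ᵥ (S.R *ᵥ u) + (S.B *ᵥ u) ⬝ᵥ (k *ᵥ (S.B *ᵥ u)) := by
    rw [hMdef, add_mulVec, dotProduct_add, ← hBd]
    simp only [mulVec_mulVec, Matrix.mul_assoc]
  rw [hstep, hu, quadForm_add_of_transpose_eq hMt, quadForm_add_of_transpose_eq hkt, hMu, hMh, hBd]
  rw [hBd]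
  ring

/-- At u = `gain k` x the square in the stage identity vanishes, which leaves the new quadratic form
as a sum of three nonnegative terms. -/
theorem posSemidef_riccatiStep {n m : ℕ} (S : LQSystem n m) (hQ : S.Q.PosSemidef)
    (hR : S.R.PosDef) {k : Matrix (Fin n) (Fin n) ℝ} (hk : k.PosSemidef) :
    (S.riccatiStep k).PosSemidef := by
  have hM := S.posDef_inputWeight hR hk
  refine PosSemidef.of_dotProduct_mulVec_nonneg ?_ fun x => ?_
  · have hQt := hQ.transpose_eq
    have hkt := hk.transpose_eq
    have hMt : (S.R + S.Bᵀ * k * S.B)⁻¹ᵀ = (S.R + S.Bᵀ * k * S.B)⁻¹ := by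
      rw [transpose_nonsing_inv, hM.posSemidef.transpose_eq]
    rw [IsHermitian, conjTranspose_eq_transpose_of_trivial, riccatiStep, transpose_sub,
      transpose_add, hQt]
    generalize (S.R + S.Bᵀ * k * S.B)⁻¹ = W at hMt ⊢
    simp only [transpose_mul, transpose_transpose, hkt, hMt, Matrix.mul_assoc]
  · have h := S.stageCost_add_eq hR hk x (S.gain k *ᵥ x)
    rw [sub_self, mulVec_zero, dotProduct_zero, add_zero] at h
    rw [star_trivial, ← h]
    exact add_nonneg (add_nonneg (hQ.quadForm_nonneg _) (hR.posSemidef.quadForm_nonneg _))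
      (hk.quadForm_nonneg _)

theorem posSemidef_riccatiK {n m : ℕ} (S : LQSystem n m) (hQ : S.Q.PosSemidef)
    (hR : S.R.PosDef) (T t : ℕ) : (S.riccatiK T t).PosSemidef := by
  rw [riccatiK]
  generalize T - t = N
  induction N with
  | zero => exact PosSemidef.zero
  | succ N ih => rw [Function.iterate_succ_apply']; exact S.posSemidef_riccatiStep hQ hR ih

theorem pathCost_nonneg {n m : ℕ} (S : LQSystem n m) (hQ : S.Q.PosSemidef) (hR : S.R.PosDef)
    (T : ℕ) (z : ℕ → Fin n → ℝ) (u : ℕ → Fin m → ℝ) : 0 ≤ S.pathCost T z u :=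
  Finset.sum_nonneg fun _ _ => add_nonneg (hQ.quadForm_nonneg _) (hR.posSemidef.quadForm_nonneg _)

/-- Completion of squares along a trajectory, for a solution `k` of the Riccati recursion. -/
theorem pathCost_add_terminal {n m : ℕ} (S : LQSystem n m) (hR : S.R.PosDef)
    (k : ℕ → Matrix (Fin n) (Fin n) ℝ) (hk : ∀ t, (k t).PosSemidef) (T : ℕ)
    (hrec : ∀ t < T, k t = S.riccatiStep (k (t + 1))) (z : ℕ → Fin n → ℝ)
    (u : ℕ → Fin m → ℝ) :
    S.pathCost T z u + S.state z u T ⬝ᵥ (k T *ᵥ S.state z u T)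
      = z 0 ⬝ᵥ (k 0 *ᵥ z 0) + ∑ t ∈ Finset.range T,
        ((u t - S.gain (k (t + 1)) *ᵥ S.state z u t) ⬝ᵥ ((S.R + S.Bᵀ * k (t + 1) * S.B) *ᵥ
            (u t - S.gain (k (t + 1)) *ᵥ S.state z u t))
          + 2 * (z (t + 1) ⬝ᵥ (k (t + 1) *ᵥ (S.A *ᵥ S.state z u t + S.B *ᵥ u t)))
          + z (t + 1) ⬝ᵥ (k (t + 1) *ᵥ z (t + 1))) := by
  induction T with
  | zero => simp [pathCost, state]
  | succ T ih =>
    have ih := ih fun t ht => hrec t (by omega)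
    have h := S.stageCost_add_eq hR (hk (T + 1)) (S.state z u T) (u T)
    rw [← hrec T (by omega)] at h
    rw [Finset.sum_range_succ, ← add_assoc, ← ih, pathCost, Finset.sum_range_succ, ← pathCost]
    rw [state, quadForm_add_of_transpose_eq (hk (T + 1)).transpose_eq]
    linarith

/-! ### Closed-loop actions. -/

theorem dynamicActions_linearFeedback {n m : ℕ} (S : LQSystem n m)
    (G : ℕ → Matrix (Fin m) (Fin n) ℝ) (z : ℕ → Fin n → ℝ) (t : ℕ) :
    S.dynamicActions (linearFeedback G) z t
      = G t *ᵥ S.state z (S.dynamicActions (linearFeedback G) z) t := by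
  rw [← history_last]
  rfl

theorem state_congr {n m : ℕ} (S : LQSystem n m) (z : ℕ → Fin n → ℝ) {u u' : ℕ → Fin m → ℝ}
    (t : ℕ) (h : ∀ s < t, u s = u' s) : S.state z u t = S.state z u' t := by
  induction t with
  | zero => rfl
  | succ t ih => rw [state, state, ih fun s hs => h s (by omega), h t (by omega)]

/-- Actions that satisfy a linear feedback law are those of the feedback policy. -/
theorem eq_dynamicActions_of_feedback {n m : ℕ} (S : LQSystem n m)
    (G : ℕ → Matrix (Fin m) (Fin n) ℝ) (z : ℕ → Fin n → ℝ) (u : ℕ → Fin m → ℝ) (T : ℕ)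
    (h : ∀ t < T, u t = G t *ᵥ S.state z u t) :
    ∀ t < T, u t = S.dynamicActions (linearFeedback G) z t := by
  intro t
  induction t using Nat.strong_induction_on with
  | _ t ih =>
    intro ht
    rw [h t ht, dynamicActions_linearFeedback, S.state_congr z t fun s hs => ih s hs (by omega)]

/-! ### Convergence of the Riccati iterates. -/

/-- The noise sequence of the deterministic problem started at `x`. -/
def initialNoise {n : ℕ} (x : Fin n → ℝ) : ℕ → Fin n → ℝ
  | 0 => x
  | _ + 1 => 0

/-- Without noise after time 0, and with k_N^N = 0, only the squares survive; this identifies the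
N-th Riccati iterate as the value of the noiseless N-stage problem. -/
theorem pathCost_initialNoise {n m : ℕ} (S : LQSystem n m) (hQ : S.Q.PosSemidef)
    (hR : S.R.PosDef) (N : ℕ) (x : Fin n → ℝ) (u : ℕ → Fin m → ℝ) :
    S.pathCost N (initialNoise x) u
      = x ⬝ᵥ (S.riccatiStep^[N] 0 *ᵥ x) + ∑ t ∈ Finset.range N,
        (u t - S.finiteGain N t *ᵥ S.state (initialNoise x) u t) ⬝ᵥ
          ((S.R + S.Bᵀ * S.riccatiK N (t + 1) * S.B) *ᵥ
            (u t - S.finiteGain N t *ᵥ S.state (initialNoise x) u t)) := by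
  have h := S.pathCost_add_terminal hR (S.riccatiK N) (S.posSemidef_riccatiK hQ hR N) N
    (fun t ht => S.riccatiK_eq ht) (initialNoise x) u
  simpa [riccatiK_self, initialNoise, finiteGain, riccatiK] using h

theorem quadForm_riccati_le_pathCost {n m : ℕ} (S : LQSystem n m) (hQ : S.Q.PosSemidef)
    (hR : S.R.PosDef) (N : ℕ) (x : Fin n → ℝ) (u : ℕ → Fin m → ℝ) :
    x ⬝ᵥ (S.riccatiStep^[N] 0 *ᵥ x) ≤ S.pathCost N (initialNoise x) u := by
  rw [S.pathCost_initialNoise hQ hR]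
  exact le_add_of_nonneg_right (Finset.sum_nonneg fun t _ =>
    (S.posDef_inputWeight hR (S.posSemidef_riccatiK hQ hR N (t + 1))).posSemidef.quadForm_nonneg _)

/-- Optimal actions for N + 1 stages are a candidate for N stages once the last, nonnegative stage
cost is dropped. -/
theorem monotone_quadForm_riccati {n m : ℕ} (S : LQSystem n m) (hQ : S.Q.PosSemidef)
    (hR : S.R.PosDef) (x : Fin n → ℝ) :
    Monotone fun N => x ⬝ᵥ (S.riccatiStep^[N] 0 *ᵥ x) := by
  refine monotone_nat_of_le_succ fun N => ?_
  set u := S.dynamicActions (linearFeedback (S.finiteGain (N + 1))) (initialNoise x) with hu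
  have h := S.pathCost_initialNoise hQ hR (N + 1) x u
  rw [Finset.sum_eq_zero fun t _ => by
    rw [hu, ← dynamicActions_linearFeedback, sub_self, zero_dotProduct], add_zero] at h
  rw [← h, pathCost, Finset.sum_range_succ, ← pathCost]
  exact (S.quadForm_riccati_le_pathCost hQ hR N x u).trans (le_add_of_nonneg_right
    (add_nonneg (hQ.quadForm_nonneg _) (hR.posSemidef.quadForm_nonneg _)))

/-- A controllable system can be steered to the origin in `n` steps. -/
theorem Controllable.exists_state_eq_zero {n m : ℕ} {S : LQSystem n m} (h : S.Controllable)
    (x : Fin n → ℝ) :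
    ∃ u : ℕ → Fin m → ℝ, (∀ t, n ≤ t → u t = 0) ∧ S.state (initialNoise x) u n = 0 := by
  have hsurj : Function.Surjective S.controllabilityMatrix.mulVecLin := by
    rw [← LinearMap.range_eq_top]
    refine Submodule.eq_top_of_finrank_eq ?_
    change S.controllabilityMatrix.rank = _
    rw [h]; simp
  obtain ⟨c, hc⟩ := hsurj (-(S.freeState (initialNoise x) n))
  rw [mulVecLin_apply] at hc
  -- Time is reversed: at time n the action u t carries A^(n-1-t) B, so it must take block n-1-t of
  -- c.
  let u : ℕ → Fin m → ℝ := fun t =>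
    if ht : t < n then fun j => c (⟨n - 1 - t, by omega⟩, j) else 0
  refine ⟨u, fun t ht => by simp [u, ht], ?_⟩
  rw [state_eq, ← eq_neg_iff_add_eq_zero, ← hc]
  rw [← Finset.sum_range_reflect, ← Fin.sum_univ_eq_sum_range
    (fun j => (S.A ^ (n - 1 - (n - 1 - j)) * S.B) *ᵥ u (n - 1 - j))]
  funext i
  simp only [Finset.sum_apply, mulVec, dotProduct, Fintype.sum_prod_type, controllabilityMatrix,
    of_apply]
  refine Finset.sum_congr rfl fun a _ => Finset.sum_congr rfl fun j _ => ?_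
  have ha := a.2
  have e : n - 1 - (n - 1 - (a : ℕ)) = a := by omega
  have hlt : n - 1 - (a : ℕ) < n := by omega
  simp only [u, hlt, dif_pos, e]

/-- The steering actions reach the origin at time n and rest there at no cost, so their n-stage cost
bounds every horizon. -/
theorem exists_bound_quadForm_riccati {n m : ℕ} (S : LQSystem n m) (hctrl : S.Controllable)
    (hQ : S.Q.PosSemidef) (hR : S.R.PosDef) (x : Fin n → ℝ) :
    ∃ C, ∀ N, x ⬝ᵥ (S.riccatiStep^[N] 0 *ᵥ x) ≤ C := by
  obtain ⟨u, hu, hx⟩ := hctrl.exists_state_eq_zero x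
  have hx' : ∀ j, S.state (initialNoise x) u (n + j) = 0 := by
    intro j
    induction j with
    | zero => exact hx
    | succ j ih => rw [← add_assoc, state, ih, hu _ (by omega)]; simp [initialNoise]
  refine ⟨S.pathCost n (initialNoise x) u, fun N => ?_⟩
  -- Passing to horizon n + N lets the cost be split at time n, even when N < n.
  refine (S.monotone_quadForm_riccati hQ hR x (Nat.le_add_left N n)).trans ?_
  refine (S.quadForm_riccati_le_pathCost hQ hR (n + N) x u).trans (le_of_eq ?_)
  rw [pathCost, Finset.sum_range_add, pathCost, add_eq_left]
  exact Finset.sum_eq_zero fun j _ => by rw [hx', hu _ (by omega)]; simp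

/-- Each quadratic form converges as a bounded monotone sequence; polarization transfers this to the
entries. -/
theorem exists_tendsto_riccati {n m : ℕ} (S : LQSystem n m) (hctrl : S.Controllable)
    (hQ : S.Q.PosSemidef) (hR : S.R.PosDef) :
    ∃ K, Tendsto (fun N => S.riccatiStep^[N] 0) atTop (𝓝 K) := by
  have hq : ∀ x : Fin n → ℝ, ∃ l, Tendsto (fun N => x ⬝ᵥ (S.riccatiStep^[N] 0 *ᵥ x)) atTop
      (𝓝 l) := by
    intro x
    obtain ⟨C, hC⟩ := S.exists_bound_quadForm_riccati hctrl hQ hR x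
    exact ⟨_, tendsto_atTop_ciSup (S.monotone_quadForm_riccati hQ hR x)
      ⟨C, by rintro _ ⟨N, rfl⟩; exact hC N⟩⟩
  choose l hl using hq
  refine ⟨Matrix.of fun i j => (l (Pi.single i 1 + Pi.single j 1) - l (Pi.single i 1)
    - l (Pi.single j 1)) / 2, tendsto_pi_nhds.2 fun i => tendsto_pi_nhds.2 fun j => ?_⟩
  refine ((((hl _).sub (hl _)).sub (hl _)).div_const 2).congr fun N => ?_
  exact (apply_eq_quadForm_of_transpose_eq (S.posSemidef_riccatiK hQ hR N 0).transpose_eq i j).symm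

theorem posSemidef_of_tendsto {n : ℕ} {k : ℕ → Matrix (Fin n) (Fin n) ℝ}
    {K : Matrix (Fin n) (Fin n) ℝ} (hk : ∀ N, (k N).PosSemidef)
    (h : Tendsto k atTop (𝓝 K)) : K.PosSemidef := by
  refine PosSemidef.of_dotProduct_mulVec_nonneg ?_ fun x => ?_
  · have h2 : Tendsto (fun N => (k N)ᵀ) atTop (𝓝 Kᵀ) :=
      (continuous_id.matrix_transpose.tendsto K).comp h
    rw [IsHermitian, conjTranspose_eq_transpose_of_trivial]
    exact tendsto_nhds_unique (h2.congr fun N => (hk N).transpose_eq) h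
  · rw [star_trivial]
    have hc : Continuous fun M : Matrix (Fin n) (Fin n) ℝ => x ⬝ᵥ (M *ᵥ x) := by fun_prop
    exact ge_of_tendsto' ((hc.tendsto K).comp h) fun N => (hk N).quadForm_nonneg x

/-- The weight at K is positive definite, so its determinant is a unit and inversion is continuous
there. -/
theorem continuousAt_inputWeight_inv {n m : ℕ} (S : LQSystem n m) (hR : S.R.PosDef)
    {K : Matrix (Fin n) (Fin n) ℝ} (hK : K.PosSemidef) :
    ContinuousAt (fun k => (S.R + S.Bᵀ * k * S.B)⁻¹) K := by
  have hM := S.posDef_inputWeight hR hK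
  have hdet := (isUnit_iff_isUnit_det _).1 hM.isUnit
  refine ContinuousAt.comp (g := Inv.inv) (continuousAt_matrix_inv _ ?_)
    (f := fun k => S.R + S.Bᵀ * k * S.B) (by fun_prop)
  exact NormedRing.inverse_continuousAt hdet.unit

theorem continuousAt_riccatiStep {n m : ℕ} (S : LQSystem n m) (hR : S.R.PosDef)
    {K : Matrix (Fin n) (Fin n) ℝ} (hK : K.PosSemidef) : ContinuousAt S.riccatiStep K := by
  have h := S.continuousAt_inputWeight_inv hR hK
  have hF : Continuous fun p : Matrix (Fin n) (Fin n) ℝ × Matrix (Fin m) (Fin m) ℝ =>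
      S.Q + S.Aᵀ * p.1 * S.A - S.Aᵀ * p.1 * S.B * p.2 * S.Bᵀ * p.1 * S.A :=
    (continuous_const.add ((continuous_const.matrix_mul continuous_fst).matrix_mul
      continuous_const)).sub ((((((continuous_const.matrix_mul continuous_fst).matrix_mul
        continuous_const).matrix_mul continuous_snd).matrix_mul continuous_const).matrix_mul
          continuous_fst).matrix_mul continuous_const)
  have hcomp := (hF.tendsto (K, (S.R + S.Bᵀ * K * S.B)⁻¹)).comp (tendsto_id.prodMk_nhds h)
  have e : S.riccatiStep = (fun p : Matrix (Fin n) (Fin n) ℝ × Matrix (Fin m) (Fin m) ℝ =>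
      S.Q + S.Aᵀ * p.1 * S.A - S.Aᵀ * p.1 * S.B * p.2 * S.Bᵀ * p.1 * S.A) ∘
        fun k => (k, (S.R + S.Bᵀ * k * S.B)⁻¹) := by
    funext k
    simp only [riccatiStep, Function.comp]
  rw [ContinuousAt, e]
  exact hcomp

theorem continuousAt_gain {n m : ℕ} (S : LQSystem n m) (hR : S.R.PosDef)
    {K : Matrix (Fin n) (Fin n) ℝ} (hK : K.PosSemidef) : ContinuousAt S.gain K := by
  have h := S.continuousAt_inputWeight_inv hR hK
  have hF : Continuous fun p : Matrix (Fin n) (Fin n) ℝ × Matrix (Fin m) (Fin m) ℝ =>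
      -(p.2 * S.Bᵀ * p.1 * S.A) :=
    (((continuous_snd.matrix_mul continuous_const).matrix_mul continuous_fst).matrix_mul
      continuous_const).neg
  have hcomp := (hF.tendsto (K, (S.R + S.Bᵀ * K * S.B)⁻¹)).comp (tendsto_id.prodMk_nhds h)
  have e : S.gain = (fun p : Matrix (Fin n) (Fin n) ℝ × Matrix (Fin m) (Fin m) ℝ =>
      -(p.2 * S.Bᵀ * p.1 * S.A)) ∘
        fun k => (k, (S.R + S.Bᵀ * k * S.B)⁻¹) := by
    funext k
    simp only [gain, Function.comp]
  rw [ContinuousAt, e]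
  exact hcomp

end LQSystem

/-! ### Square integrable random vectors. -/

theorem memLp_mulVec {Ω ι κ : Type*} [MeasurableSpace Ω] {P : Measure Ω} [Fintype ι] [Fintype κ]
    {p : ℝ≥0∞} {X : Ω → κ → ℝ} (hX : MemLp X p P) (M : Matrix ι κ ℝ) :
    MemLp (fun ω => M *ᵥ X ω) p P :=
  M.mulVecLin.toContinuousLinearMap.comp_memLp' hX

theorem integrable_dotProduct {Ω ι : Type*} [MeasurableSpace Ω] {P : Measure Ω} [Fintype ι]
    {X Y : Ω → ι → ℝ} (hX : MemLp X 2 P) (hY : MemLp Y 2 P) :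
    Integrable (fun ω => X ω ⬝ᵥ Y ω) P :=
  integrable_finsetSum _ fun i _ => (memLp_pi_iff.1 hX i).integrable_mul (memLp_pi_iff.1 hY i)

theorem integrable_quadForm {Ω ι : Type*} [MeasurableSpace Ω] {P : Measure Ω} [Fintype ι]
    {X : Ω → ι → ℝ} (hX : MemLp X 2 P) (M : Matrix ι ι ℝ) :
    Integrable (fun ω => X ω ⬝ᵥ (M *ᵥ X ω)) P :=
  integrable_dotProduct hX (memLp_mulVec hX M)

theorem Measurable.matrix_mulVec {Ω ι κ : Type*} {mΩ : MeasurableSpace Ω} [Fintype ι] [Fintype κ]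
    {X : Ω → κ → ℝ} (hX : Measurable X) (M : Matrix ι κ ℝ) : Measurable fun ω => M *ᵥ X ω :=
  (M.mulVecLin.toContinuousLinearMap.continuous.measurable).comp hX

theorem Measurable.dotProduct {Ω ι : Type*} {mΩ : MeasurableSpace Ω} [Fintype ι]
    {X Y : Ω → ι → ℝ} (hX : Measurable X) (hY : Measurable Y) :
    Measurable fun ω => X ω ⬝ᵥ Y ω := by
  unfold _root_.dotProduct
  fun_prop

theorem integral_add_sum_add_add {Ω : Type*} [MeasurableSpace Ω] {P : Measure Ω} {a : Ω → ℝ}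
    {f g h : ℕ → Ω → ℝ} {T : ℕ} (ha : Integrable a P) (hf : ∀ t < T, Integrable (f t) P)
    (hg : ∀ t < T, Integrable (g t) P) (hh : ∀ t < T, Integrable (h t) P) :
    ∫ ω, (a ω + ∑ t ∈ Finset.range T, (f t ω + g t ω + h t ω)) ∂P
      = ∫ ω, a ω ∂P + ∑ t ∈ Finset.range T, (∫ ω, f t ω ∂P + ∫ ω, g t ω ∂P + ∫ ω, h t ω ∂P) := by
  have hi : ∀ t ∈ Finset.range T, Integrable (fun ω => f t ω + g t ω + h t ω) P := fun t ht =>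
    ((hf t (Finset.mem_range.1 ht)).add (hg t (Finset.mem_range.1 ht))).add
      (hh t (Finset.mem_range.1 ht))
  rw [integral_add ha (integrable_finsetSum _ hi), integral_finsetSum _ hi]
  refine congrArg _ (Finset.sum_congr rfl fun t ht => ?_)
  have ht := Finset.mem_range.1 ht
  have hfg : Integrable (fun ω => f t ω + g t ω) P := (hf t ht).add (hg t ht)
  rw [integral_add hfg (hh t ht), integral_add (hf t ht) (hg t ht)]

/-- A sequence of i.i.d., centered, square integrable random vectors. -/
structure IsWhiteNoise {n : ℕ} {Ω : Type*} [MeasurableSpace Ω] (P : Measure Ω)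
    (ζ : ℕ → Ω → Fin n → ℝ) : Prop where
  measurable : ∀ k, Measurable (ζ k)
  indep : iIndepFun ζ P
  ident : ∀ k, IdentDistrib (ζ k) (ζ 0) P P
  memLp : ∀ k, MemLp (ζ k) 2 P
  mean : ∀ k, ∫ ω, ζ k ω ∂P = 0

/-- The energy `E[ζ_0ᵀ M ζ_0]` of the noise in the quadratic form of `M`. -/
noncomputable def noiseEnergy {n : ℕ} {Ω : Type*} [MeasurableSpace Ω] (P : Measure Ω)
    (ζ : ℕ → Ω → Fin n → ℝ) (M : Matrix (Fin n) (Fin n) ℝ) : ℝ :=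
  ∫ ω, ζ 0 ω ⬝ᵥ (M *ᵥ ζ 0 ω) ∂P

/-! ### White noise: filtration, second moments, orthogonality to the past. -/

namespace IsWhiteNoise

/-- The natural filtration of the noise. -/
def filtration {n : ℕ} {Ω : Type*} [mΩ : MeasurableSpace Ω] {P : Measure Ω}
    {ζ : ℕ → Ω → Fin n → ℝ} (hζ : IsWhiteNoise P ζ) : Filtration ℕ mΩ :=
  Filtration.natural ζ fun k => (hζ.measurable k).stronglyMeasurable

theorem measurable_filtration {n : ℕ} {Ω : Type*} [MeasurableSpace Ω] {P : Measure Ω}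
    {ζ : ℕ → Ω → Fin n → ℝ} (hζ : IsWhiteNoise P ζ) {k t : ℕ} (h : k ≤ t) :
    Measurable[hζ.filtration t] (ζ k) :=
  ((Filtration.stronglyAdapted_natural
    (fun k => (hζ.measurable k).stronglyMeasurable) k).measurable).mono
      (hζ.filtration.mono h) le_rfl

theorem integral_quadForm {n : ℕ} {Ω : Type*} [MeasurableSpace Ω] {P : Measure Ω}
    {ζ : ℕ → Ω → Fin n → ℝ} (hζ : IsWhiteNoise P ζ) (k : ℕ) (M : Matrix (Fin n) (Fin n) ℝ) :
    ∫ ω, ζ k ω ⬝ᵥ (M *ᵥ ζ k ω) ∂P = noiseEnergy P ζ M := by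
  have hm : Measurable fun x : Fin n → ℝ => x ⬝ᵥ (M *ᵥ x) :=
    measurable_id.dotProduct (measurable_id.matrix_mulVec M)
  exact ((hζ.ident k).comp hm).integral_eq

/-- The noise is uncorrelated with the past. -/
theorem integral_dotProduct_eq_zero {n : ℕ} {Ω : Type*} [MeasurableSpace Ω] {P : Measure Ω}
    [IsProbabilityMeasure P]
    {ζ : ℕ → Ω → Fin n → ℝ} (hζ : IsWhiteNoise P ζ) (t : ℕ) {Y : Ω → Fin n → ℝ}
    (hYm : Measurable[hζ.filtration t] Y) (hY : MemLp Y 2 P) :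
    ∫ ω, ζ (t + 1) ω ⬝ᵥ Y ω ∂P = 0 := by
  have hind : IndepFun (ζ (t + 1)) Y P := by
    rw [IndepFun_iff_Indep]
    exact indep_of_indep_of_le_right (hζ.indep.indep_comap_natural_of_lt
      (fun k => (hζ.measurable k).stronglyMeasurable) (Nat.lt_succ_self t)) hYm.comap_le
  have hL := hζ.memLp (t + 1)
  have hi : ∀ i, Integrable (fun ω => ζ (t + 1) ω i * Y ω i) P := fun i =>
    (memLp_pi_iff.1 hL i).integrable_mul (memLp_pi_iff.1 hY i)
  unfold dotProduct
  rw [integral_finsetSum _ fun i _ => hi i]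
  refine Finset.sum_eq_zero fun i _ => ?_
  have h1 : IndepFun (fun ω => ζ (t + 1) ω i) (fun ω => Y ω i) P :=
    hind.comp (measurable_pi_apply i) (measurable_pi_apply i)
  rw [h1.integral_fun_mul_eq_mul_integral (memLp_pi_iff.1 hL i).1 (memLp_pi_iff.1 hY i).1,
    ← eval_integral fun j => (memLp_pi_iff.1 hL j).integrable (by norm_num), hζ.mean]
  simp

end IsWhiteNoise

/-- The energy is a linear function of the entries of M, with the second moments of ζ 0 as
coefficients. -/
theorem continuous_noiseEnergy {n : ℕ} {Ω : Type*} [MeasurableSpace Ω] {P : Measure Ω}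
    {ζ : ℕ → Ω → Fin n → ℝ} (hζ : IsWhiteNoise P ζ) : Continuous (noiseEnergy P ζ) := by
  have h : noiseEnergy P ζ = fun M => ∑ i, ∑ j, M i j * ∫ ω, ζ 0 ω i * ζ 0 ω j ∂P := by
    funext M
    have hL := memLp_pi_iff.1 (hζ.memLp 0)
    have hi : ∀ i j, Integrable (fun ω => M i j * (ζ 0 ω i * ζ 0 ω j)) P := fun i j =>
      ((hL i).integrable_mul (hL j)).const_mul _
    simp_rw [noiseEnergy, dotProduct, mulVec, dotProduct, Finset.mul_sum,
      fun ω i j => mul_left_comm (ζ 0 ω i) (M i j) (ζ 0 ω j)]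
    rw [integral_finsetSum _ fun i _ => integrable_finsetSum _ fun j _ => hi i j]
    refine Finset.sum_congr rfl fun i _ => ?_
    rw [integral_finsetSum _ fun j _ => hi i j]
    exact Finset.sum_congr rfl fun j _ => integral_const_mul _ _
  rw [h]
  fun_prop

theorem noiseEnergy_nonneg {n : ℕ} {Ω : Type*} [MeasurableSpace Ω] (P : Measure Ω)
    (ζ : ℕ → Ω → Fin n → ℝ) {M : Matrix (Fin n) (Fin n) ℝ} (hM : M.PosSemidef) :
    0 ≤ noiseEnergy P ζ M :=
  integral_nonneg fun _ => hM.quadForm_nonneg _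

namespace LQSystem

/-! ### Expected costs of adapted action processes. -/

theorem measurable_state {n m : ℕ} (S : LQSystem n m) {Ω : Type*} [MeasurableSpace Ω]
    {P : Measure Ω} {ζ : ℕ → Ω → Fin n → ℝ} (hζ : IsWhiteNoise P ζ) {u : Ω → ℕ → Fin m → ℝ}
    (hu : ∀ t, Measurable[hζ.filtration t] fun ω => u ω t) (t : ℕ) :
    Measurable[hζ.filtration t] fun ω => S.state (fun k => ζ k ω) (u ω) t := by
  induction t with
  | zero => exact hζ.measurable_filtration le_rfl
  | succ t ih =>
    have hle := hζ.filtration.mono (Nat.le_succ t)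
    exact (((ih.mono hle le_rfl).matrix_mulVec S.A).add
      (((hu t).mono hle le_rfl).matrix_mulVec S.B)).add (hζ.measurable_filtration le_rfl)

theorem memLp_state {n m : ℕ} (S : LQSystem n m) {Ω : Type*} [MeasurableSpace Ω]
    {P : Measure Ω} {ζ : ℕ → Ω → Fin n → ℝ} (hζ : IsWhiteNoise P ζ) {u : Ω → ℕ → Fin m → ℝ}
    (t : ℕ) (hu : ∀ s < t, MemLp (fun ω => u ω s) 2 P) :
    MemLp (fun ω => S.state (fun k => ζ k ω) (u ω) t) 2 P := by
  induction t with
  | zero => exact hζ.memLp 0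
  | succ t ih =>
    exact ((memLp_mulVec (ih fun s hs => hu s (by omega)) S.A).add
      (memLp_mulVec (hu t (by omega)) S.B)).add (hζ.memLp (t + 1))

theorem integrable_pathCost {n m : ℕ} (S : LQSystem n m) {Ω : Type*} [MeasurableSpace Ω]
    {P : Measure Ω} {ζ : ℕ → Ω → Fin n → ℝ} (hζ : IsWhiteNoise P ζ) {u : Ω → ℕ → Fin m → ℝ}
    (T : ℕ) (hu : ∀ s < T, MemLp (fun ω => u ω s) 2 P) :
    Integrable (fun ω => S.pathCost T (fun k => ζ k ω) (u ω)) P := by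
  refine integrable_finsetSum _ fun t ht => ?_
  have ht := Finset.mem_range.1 ht
  exact (integrable_quadForm (S.memLp_state hζ t fun s hs => hu s (by omega)) _).add
    (integrable_quadForm (hu t ht) _)

/-- An action process of finite expected cost is square integrable. -/
theorem memLp_of_lintegral_pathCost_ne_top {n m : ℕ} (S : LQSystem n m) (hQ : S.Q.PosSemidef)
    (hR : S.R.PosDef) {Ω : Type*} [MeasurableSpace Ω]
    {P : Measure Ω} {ζ : ℕ → Ω → Fin n → ℝ} (hζ : IsWhiteNoise P ζ) {u : Ω → ℕ → Fin m → ℝ}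
    (hu : ∀ t, Measurable[hζ.filtration t] fun ω => u ω t) (T : ℕ)
    (hfin : ∫⁻ ω, ENNReal.ofReal (S.pathCost T (fun k => ζ k ω) (u ω)) ∂P ≠ ⊤) :
    ∀ t < T, MemLp (fun ω => u ω t) 2 P := by
  have hum : ∀ t, Measurable fun ω => u ω t := fun t => (hu t).mono (hζ.filtration.le t) le_rfl
  have hxm : ∀ t, Measurable fun ω => S.state (fun k => ζ k ω) (u ω) t := fun t =>
    (S.measurable_state hζ hu t).mono (hζ.filtration.le t) le_rfl
  have hcm : Measurable fun ω => S.pathCost T (fun k => ζ k ω) (u ω) :=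
    Finset.measurable_sum _ fun t _ => ((hxm t).dotProduct ((hxm t).matrix_mulVec _)).add
      ((hum t).dotProduct ((hum t).matrix_mulVec _))
  have hint : Integrable (fun ω => S.pathCost T (fun k => ζ k ω) (u ω)) P :=
    (lintegral_ofReal_ne_top_iff_integrable hcm.aestronglyMeasurable
      (ae_of_all _ fun ω => S.pathCost_nonneg hQ hR T _ _)).1 hfin
  intro t ht
  refine memLp_pi_iff.2 fun i => ?_
  have hui : Measurable fun ω => u ω t i := (measurable_pi_apply i).comp (hum t)
  refine (memLp_two_iff_integrable_sq hui.aestronglyMeasurable).2 ?_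
  -- The square of the i-th coordinate is at most R⁻¹ i i times uᵀRu, and uᵀRu is part of one
  -- nonnegative stage of the path cost.
  refine (hint.const_mul (S.R⁻¹ i i)).mono' (hui.pow_const 2).aestronglyMeasurable
    (ae_of_all _ fun ω => ?_)
  rw [Real.norm_of_nonneg (sq_nonneg _)]
  refine (hR.sq_apply_le (u ω t) i).trans
    (mul_le_mul_of_nonneg_left ?_ hR.inv.posSemidef.diag_nonneg)
  have h1 : ∀ s, 0 ≤ S.state (fun k => ζ k ω) (u ω) s ⬝ᵥ
      (S.Q *ᵥ S.state (fun k => ζ k ω) (u ω) s) := fun s => hQ.quadForm_nonneg _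
  refine le_trans (le_add_of_nonneg_left (h1 t)) ?_
  exact Finset.single_le_sum (f := fun s => S.state (fun k => ζ k ω) (u ω) s ⬝ᵥ
      (S.Q *ᵥ S.state (fun k => ζ k ω) (u ω) s) + u ω s ⬝ᵥ (S.R *ᵥ u ω s))
    (fun s _ => add_nonneg (h1 s) (hR.posSemidef.quadForm_nonneg _)) (Finset.mem_range.2 ht)

theorem memLp_sub_gain {n m : ℕ} (S : LQSystem n m) {Ω : Type*} [MeasurableSpace Ω]
    {P : Measure Ω} {ζ : ℕ → Ω → Fin n → ℝ} (hζ : IsWhiteNoise P ζ) {u : Ω → ℕ → Fin m → ℝ}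
    {T : ℕ} (hu : ∀ s < T, MemLp (fun ω => u ω s) 2 P) {t : ℕ} (ht : t < T)
    (G : Matrix (Fin m) (Fin n) ℝ) :
    MemLp (fun ω => u ω t - G *ᵥ S.state (fun k => ζ k ω) (u ω) t) 2 P :=
  (hu t ht).sub (memLp_mulVec (S.memLp_state hζ t fun s hs => hu s (by omega)) _)

/-- The expected cost of a square integrable adapted action process, for a solution `k` of the
Riccati recursion. -/
theorem integral_pathCost_add_terminal {n m : ℕ} (S : LQSystem n m) (hR : S.R.PosDef)
    {Ω : Type*} [MeasurableSpace Ω] {P : Measure Ω} [IsProbabilityMeasure P]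
    {ζ : ℕ → Ω → Fin n → ℝ} (hζ : IsWhiteNoise P ζ) {u : Ω → ℕ → Fin m → ℝ}
    (hum : ∀ t, Measurable[hζ.filtration t] fun ω => u ω t) (T : ℕ)
    (hu : ∀ s < T, MemLp (fun ω => u ω s) 2 P)
    (k : ℕ → Matrix (Fin n) (Fin n) ℝ) (hk : ∀ t, (k t).PosSemidef)
    (hrec : ∀ t < T, k t = S.riccatiStep (k (t + 1))) :
    ∫ ω, S.pathCost T (fun k => ζ k ω) (u ω) ∂P
        + ∫ ω, S.state (fun k => ζ k ω) (u ω) T ⬝ᵥ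
            (k T *ᵥ S.state (fun k => ζ k ω) (u ω) T) ∂P
      = ∑ t ∈ Finset.range (T + 1), noiseEnergy P ζ (k t)
        + ∑ t ∈ Finset.range T, ∫ ω,
          (u ω t - S.gain (k (t + 1)) *ᵥ S.state (fun k => ζ k ω) (u ω) t) ⬝ᵥ
            ((S.R + S.Bᵀ * k (t + 1) * S.B) *ᵥ
              (u ω t - S.gain (k (t + 1)) *ᵥ S.state (fun k => ζ k ω) (u ω) t)) ∂P := by
  have hx : ∀ t ≤ T, MemLp (fun ω => S.state (fun k => ζ k ω) (u ω) t) 2 P := fun t ht =>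
    S.memLp_state hζ t fun s hs => hu s (by omega)
  have hy : ∀ t < T, MemLp (fun ω => k (t + 1) *ᵥ
      (S.A *ᵥ S.state (fun k => ζ k ω) (u ω) t + S.B *ᵥ u ω t)) 2 P := fun t ht =>
    memLp_mulVec ((memLp_mulVec (hx t ht.le) S.A).add (memLp_mulVec (hu t ht) S.B)) _
  have hym : ∀ t, Measurable[hζ.filtration t] (fun ω => k (t + 1) *ᵥ
      (S.A *ᵥ S.state (fun k => ζ k ω) (u ω) t + S.B *ᵥ u ω t)) := fun t =>
    (((S.measurable_state hζ hum t).matrix_mulVec S.A).add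
      ((hum t).matrix_mulVec S.B)).matrix_mulVec _
  have hI1 : ∀ t < T, Integrable (fun ω =>
      (u ω t - S.gain (k (t + 1)) *ᵥ S.state (fun k => ζ k ω) (u ω) t) ⬝ᵥ
            ((S.R + S.Bᵀ * k (t + 1) * S.B) *ᵥ
              (u ω t - S.gain (k (t + 1)) *ᵥ S.state (fun k => ζ k ω) (u ω) t))) P :=
    fun t ht => integrable_quadForm (S.memLp_sub_gain hζ hu ht _) _
  have hI2 : ∀ t < T, Integrable (fun ω => 2 * (ζ (t + 1) ω ⬝ᵥ (k (t + 1) *ᵥ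
      (S.A *ᵥ S.state (fun k => ζ k ω) (u ω) t + S.B *ᵥ u ω t)))) P := fun t ht =>
    (integrable_dotProduct (hζ.memLp _) (hy t ht)).const_mul 2
  have hI3 : ∀ s t, Integrable (fun ω => ζ s ω ⬝ᵥ (k t *ᵥ ζ s ω)) P := fun s t =>
    integrable_quadForm (hζ.memLp s) _
  rw [← integral_add (S.integrable_pathCost hζ T hu) (integrable_quadForm (hx T le_rfl) _)]
  simp_rw [S.pathCost_add_terminal hR k hk T hrec]
  refine (integral_add_sum_add_add (hI3 0 0) hI1 hI2 fun t _ => hI3 (t + 1) (t + 1)).trans ?_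
  -- X_0 and all w^t share their law, so each noise term depends only on its weight k t.
  simp_rw [hζ.integral_quadForm, integral_const_mul]
  have hz : ∀ t ∈ Finset.range T, 2 * ∫ ω, ζ (t + 1) ω ⬝ᵥ (k (t + 1) *ᵥ
      (S.A *ᵥ S.state (fun k => ζ k ω) (u ω) t + S.B *ᵥ u ω t)) ∂P = 0 := fun t ht => by
    rw [hζ.integral_dotProduct_eq_zero t (hym t) (hy t (Finset.mem_range.1 ht)), mul_zero]
  rw [Finset.sum_range_succ', Finset.sum_add_distrib, Finset.sum_add_distrib,
    Finset.sum_eq_zero hz]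
  ring

end LQSystem

namespace LQSystem

/-! ### Measurability of policies and actions. -/

theorem measurable_history {n m : ℕ} (S : LQSystem n m) {g : TeamPolicy n m}
    (hg : g ∈ admissiblePolicies n m) (t : ℕ) :
    Measurable fun z : ℕ → Fin n → ℝ => S.history g z t := by
  induction t with
  | zero => exact measurable_pi_lambda _ fun _ => measurable_pi_apply 0
  | succ t ih =>
    refine measurable_pi_lambda _ fun s => ?_
    induction s using Fin.lastCases with
    | last =>
      simp only [history, Fin.snoc_last]
      exact ((((measurable_pi_apply (Fin.last t)).comp ih).matrix_mulVec S.A).add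
        (((hg t).comp ih).matrix_mulVec S.B)).add (measurable_pi_apply (t + 1))
    | cast s =>
      simp only [history, Fin.snoc_castSucc]
      exact (measurable_pi_apply s).comp ih

theorem measurable_noiseOf {n m : ℕ} (S : LQSystem n m) (t : ℕ) :
    Measurable (S.noiseOf : (Fin (t + 1) → Fin n → ℝ) → ℕ → Fin n → ℝ) := by
  refine measurable_pi_lambda _ fun k => ?_
  cases k with
  | zero => exact measurable_pi_apply 0
  | succ k =>
    by_cases h : k + 1 < t + 1
    · simp only [noiseOf, h, dif_pos]
      exact (measurable_pi_apply _).sub ((measurable_pi_apply _).matrix_mulVec S.A)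
    · simp only [noiseOf, h, dif_neg, not_false_eq_true]
      exact measurable_const

theorem staticReduction_mem {n m : ℕ} (S : LQSystem n m) {g : TeamPolicy n m}
    (hg : g ∈ admissiblePolicies n m) : S.staticReduction g ∈ admissiblePolicies n m :=
  fun t => (hg t).comp ((S.measurable_history hg t).comp (S.measurable_noiseOf t))

theorem linearFeedback_mem {n m : ℕ} (G : ℕ → Matrix (Fin m) (Fin n) ℝ) :
    linearFeedback G ∈ admissiblePolicies n m :=
  fun t => (measurable_pi_apply (Fin.last t)).matrix_mulVec (G t)

/-- The uncontrolled states up to t involve only noise up to t. Adaptedness is all that the lower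
bounds need from a policy. -/
theorem measurable_staticActions {n m : ℕ} (S : LQSystem n m) {Ω : Type*} [MeasurableSpace Ω]
    {P : Measure Ω} {ζ : ℕ → Ω → Fin n → ℝ} (hζ : IsWhiteNoise P ζ) {γ : TeamPolicy n m}
    (hγ : γ ∈ admissiblePolicies n m) (t : ℕ) :
    Measurable[hζ.filtration t] fun ω => S.staticActions γ (fun k => ζ k ω) t := by
  refine (hγ t).comp (@measurable_pi_lambda _ _ _ (_) _ _ fun s => ?_)
  unfold staticInfo freeState
  refine Finset.measurable_sum (Finset.range (s + 1)) fun k hk => ?_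
  have hk := Finset.mem_range.1 hk
  have hs := s.2
  exact (hζ.measurable_filtration (by omega)).matrix_mulVec _

theorem staticActions_linearFeedback {n m : ℕ} (S : LQSystem n m)
    (G : ℕ → Matrix (Fin m) (Fin n) ℝ) (z : ℕ → Fin n → ℝ) (t : ℕ) :
    S.staticActions (S.staticReduction (linearFeedback G)) z t
      = G t *ᵥ S.state z (S.staticActions (S.staticReduction (linearFeedback G)) z) t := by
  rw [staticActions_staticReduction]
  exact S.dynamicActions_linearFeedback G z t

theorem memLp_staticActions_linearFeedback {n m : ℕ} (S : LQSystem n m) {Ω : Type*}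
    [MeasurableSpace Ω] {P : Measure Ω} {ζ : ℕ → Ω → Fin n → ℝ} (hζ : IsWhiteNoise P ζ)
    (G : ℕ → Matrix (Fin m) (Fin n) ℝ) (t : ℕ) :
    MemLp (fun ω => S.staticActions (S.staticReduction (linearFeedback G)) (fun k => ζ k ω) t)
      2 P := by
  induction t using Nat.strong_induction_on with
  | _ t ih =>
    simp_rw [S.staticActions_linearFeedback G _ t]
    exact memLp_mulVec (S.memLp_state hζ t ih) (G t)

/-! ### Finite-horizon optimality. -/

/-- The optimal value of the unnormalized cost over the horizon `T`. -/
noncomputable def finiteValue {n m : ℕ} (S : LQSystem n m) {Ω : Type*} [MeasurableSpace Ω]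
    (P : Measure Ω) (ζ : ℕ → Ω → Fin n → ℝ) (T : ℕ) : ℝ :=
  ∑ t ∈ Finset.range (T + 1), noiseEnergy P ζ (S.riccatiK T t)

theorem lintegral_pathCost {n m : ℕ} (S : LQSystem n m) (hQ : S.Q.PosSemidef) (hR : S.R.PosDef)
    {Ω : Type*} [MeasurableSpace Ω] {P : Measure Ω}
    {ζ : ℕ → Ω → Fin n → ℝ} (hζ : IsWhiteNoise P ζ) {u : Ω → ℕ → Fin m → ℝ} (T : ℕ)
    (hu : ∀ s < T, MemLp (fun ω => u ω s) 2 P) :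
    ∫⁻ ω, ENNReal.ofReal (S.pathCost T (fun k => ζ k ω) (u ω)) ∂P
      = ENNReal.ofReal (∫ ω, S.pathCost T (fun k => ζ k ω) (u ω) ∂P) :=
  (ofReal_integral_eq_lintegral_ofReal (S.integrable_pathCost hζ T hu)
    (ae_of_all _ fun _ => S.pathCost_nonneg hQ hR T _ _)).symm

/-- The terminal weight is zero, so the excess over the optimal value is exactly the weighted mean
square deviation from the Riccati feedback. -/
theorem integral_pathCost {n m : ℕ} (S : LQSystem n m) (hQ : S.Q.PosSemidef) (hR : S.R.PosDef)
    {Ω : Type*} [MeasurableSpace Ω] {P : Measure Ω} [IsProbabilityMeasure P]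
    {ζ : ℕ → Ω → Fin n → ℝ} (hζ : IsWhiteNoise P ζ) {u : Ω → ℕ → Fin m → ℝ}
    (hum : ∀ t, Measurable[hζ.filtration t] fun ω => u ω t) (T : ℕ)
    (hu : ∀ s < T, MemLp (fun ω => u ω s) 2 P) :
    ∫ ω, S.pathCost T (fun k => ζ k ω) (u ω) ∂P
      = S.finiteValue P ζ T + ∑ t ∈ Finset.range T, ∫ ω,
          (u ω t - S.finiteGain T t *ᵥ S.state (fun k => ζ k ω) (u ω) t) ⬝ᵥ
            ((S.R + S.Bᵀ * S.riccatiK T (t + 1) * S.B) *ᵥ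
              (u ω t - S.finiteGain T t *ᵥ S.state (fun k => ζ k ω) (u ω) t)) ∂P := by
  have h := S.integral_pathCost_add_terminal hR hζ hum T hu (S.riccatiK T)
    (S.posSemidef_riccatiK hQ hR T) fun t ht => S.riccatiK_eq ht
  simpa only [riccatiK_self, zero_mulVec, dotProduct_zero, integral_zero, add_zero,
    finiteValue, finiteGain] using h

theorem ofReal_finiteValue_le {n m : ℕ} (S : LQSystem n m) (hQ : S.Q.PosSemidef)
    (hR : S.R.PosDef) {Ω : Type*} [MeasurableSpace Ω] {P : Measure Ω} [IsProbabilityMeasure P]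
    {ζ : ℕ → Ω → Fin n → ℝ} (hζ : IsWhiteNoise P ζ) {u : Ω → ℕ → Fin m → ℝ}
    (hum : ∀ t, Measurable[hζ.filtration t] fun ω => u ω t) (T : ℕ) :
    ENNReal.ofReal (S.finiteValue P ζ T)
      ≤ ∫⁻ ω, ENNReal.ofReal (S.pathCost T (fun k => ζ k ω) (u ω)) ∂P := by
  by_cases hfin : ∫⁻ ω, ENNReal.ofReal (S.pathCost T (fun k => ζ k ω) (u ω)) ∂P = ⊤
  · rw [hfin]; exact le_top
  have hu := S.memLp_of_lintegral_pathCost_ne_top hQ hR hζ hum T hfin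
  rw [S.lintegral_pathCost hQ hR hζ T hu, S.integral_pathCost hQ hR hζ hum T hu]
  refine ENNReal.ofReal_le_ofReal (le_add_of_nonneg_right ?_)
  exact Finset.sum_nonneg fun t _ => integral_nonneg fun ω =>
    (S.posDef_inputWeight hR (S.posSemidef_riccatiK hQ hR T (t + 1))).posSemidef.quadForm_nonneg _

theorem lintegral_pathCost_finiteGain {n m : ℕ} (S : LQSystem n m) (hQ : S.Q.PosSemidef)
    (hR : S.R.PosDef) {Ω : Type*} [MeasurableSpace Ω] {P : Measure Ω} [IsProbabilityMeasure P]
    {ζ : ℕ → Ω → Fin n → ℝ} (hζ : IsWhiteNoise P ζ) (T : ℕ) :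
    ∫⁻ ω, ENNReal.ofReal (S.pathCost T (fun k => ζ k ω)
        (S.staticActions (S.staticReduction (linearFeedback (S.finiteGain T))) fun k => ζ k ω)) ∂P
      = ENNReal.ofReal (S.finiteValue P ζ T) := by
  have hu := fun t (_ : t < T) => S.memLp_staticActions_linearFeedback hζ (S.finiteGain T) t
  rw [S.lintegral_pathCost hQ hR hζ T hu, S.integral_pathCost hQ hR hζ
    (S.measurable_staticActions hζ (S.staticReduction_mem (linearFeedback_mem _))) T hu,
    Finset.sum_eq_zero fun t _ => ?_, add_zero]
  simp_rw [← S.staticActions_linearFeedback]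
  simp

/-- Finite-horizon optimal actions obey the Riccati feedback law almost surely. -/
theorem ae_eq_feedback_of_lintegral_le {n m : ℕ} (S : LQSystem n m) (hQ : S.Q.PosSemidef)
    (hR : S.R.PosDef) {Ω : Type*} [MeasurableSpace Ω] {P : Measure Ω} [IsProbabilityMeasure P]
    {ζ : ℕ → Ω → Fin n → ℝ} (hζ : IsWhiteNoise P ζ) {u : Ω → ℕ → Fin m → ℝ}
    (hum : ∀ t, Measurable[hζ.filtration t] fun ω => u ω t) (T : ℕ)
    (hle : ∫⁻ ω, ENNReal.ofReal (S.pathCost T (fun k => ζ k ω) (u ω)) ∂P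
      ≤ ENNReal.ofReal (S.finiteValue P ζ T)) :
    ∀ᵐ ω ∂P, ∀ t < T, u ω t = S.finiteGain T t *ᵥ S.state (fun k => ζ k ω) (u ω) t := by
  have hu := S.memLp_of_lintegral_pathCost_ne_top hQ hR hζ hum T
    (hle.trans_lt ENNReal.ofReal_lt_top).ne
  have hV : 0 ≤ S.finiteValue P ζ T := Finset.sum_nonneg fun t _ =>
    noiseEnergy_nonneg P ζ (S.posSemidef_riccatiK hQ hR T t)
  have hM := fun t => S.posDef_inputWeight hR (S.posSemidef_riccatiK hQ hR T (t + 1))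
  rw [S.lintegral_pathCost hQ hR hζ T hu, ENNReal.ofReal_le_ofReal_iff hV,
    S.integral_pathCost hQ hR hζ hum T hu, add_le_iff_nonpos_right] at hle
  have hnn : ∀ t ∈ Finset.range T, 0 ≤ ∫ ω,
      (u ω t - S.finiteGain T t *ᵥ S.state (fun k => ζ k ω) (u ω) t) ⬝ᵥ
        ((S.R + S.Bᵀ * S.riccatiK T (t + 1) * S.B) *ᵥ
          (u ω t - S.finiteGain T t *ᵥ S.state (fun k => ζ k ω) (u ω) t)) ∂P := fun t _ =>
    integral_nonneg fun ω => (hM t).posSemidef.quadForm_nonneg _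
  -- The nonnegative excess terms have sum at most 0, so each vanishes; positive definiteness then
  -- kills the deviation itself.
  have hz := (Finset.sum_eq_zero_iff_of_nonneg hnn).1 (le_antisymm hle (Finset.sum_nonneg hnn))
  simp_rw [ae_all_iff]
  intro t ht
  have h0 := (integral_eq_zero_iff_of_nonneg (fun ω => (hM t).posSemidef.quadForm_nonneg _)
    (integrable_quadForm (S.memLp_sub_gain hζ hu ht _) _)).1 (hz t (Finset.mem_range.2 ht))
  filter_upwards [h0] with ω hω
  by_contra hne
  exact ((hM t).quadForm_pos (sub_ne_zero.2 hne)).ne' hω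

end LQSystem

theorem isTeamOptimal_iff {α : Type*} {Γ : Set α} {J : α → ℝ≥0∞} {γ : α} :
    IsTeamOptimal Γ J γ ↔ γ ∈ Γ ∧ ∀ γ' ∈ Γ, J γ ≤ J γ' := by
  refine and_congr_right fun h => ⟨fun e γ' h' => e ▸ iInf₂_le γ' h', fun h' => ?_⟩
  exact le_antisymm (le_iInf₂ h') (iInf₂_le γ h)

namespace LQSystem

theorem isTeamOptimal_staticJ_finiteGain {n m : ℕ} (S : LQSystem n m) (hQ : S.Q.PosSemidef)
    (hR : S.R.PosDef) {Ω : Type*} [MeasurableSpace Ω] {P : Measure Ω} [IsProbabilityMeasure P]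
    {ζ : ℕ → Ω → Fin n → ℝ} (hζ : IsWhiteNoise P ζ) (T : ℕ) :
    IsTeamOptimal (admissiblePolicies n m) (S.staticJ P ζ T)
      (S.staticReduction (linearFeedback (S.finiteGain T))) := by
  refine isTeamOptimal_iff.2 ⟨S.staticReduction_mem (linearFeedback_mem _), fun γ hγ => ?_⟩
  refine ENNReal.div_le_div_right ?_ _
  rw [S.lintegral_pathCost_finiteGain hQ hR hζ]
  exact S.ofReal_finiteValue_le hQ hR hζ (S.measurable_staticActions hζ hγ) T

/-- Every finite-horizon optimal policy almost surely generates the actions of the Riccati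
feedback. -/
theorem ae_eq_of_isTeamOptimal_staticJ {n m : ℕ} (S : LQSystem n m) (hQ : S.Q.PosSemidef)
    (hR : S.R.PosDef) {Ω : Type*} [MeasurableSpace Ω] {P : Measure Ω} [IsProbabilityMeasure P]
    {ζ : ℕ → Ω → Fin n → ℝ} (hζ : IsWhiteNoise P ζ) {T : ℕ} {γ : TeamPolicy n m}
    (hγ : IsTeamOptimal (admissiblePolicies n m) (S.staticJ P ζ T) γ) :
    ∀ᵐ ω ∂P, ∀ t < T, γ t (S.staticInfo (fun k => ζ k ω) t)
      = S.staticReduction (linearFeedback (S.finiteGain T)) t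
          (S.staticInfo (fun k => ζ k ω) t) := by
  -- For T = 0 there is no t < T; for T > 0 the factor 1/T cancels.
  rcases T.eq_zero_or_pos with rfl | hT
  · simp
  obtain ⟨hmem, hle⟩ := isTeamOptimal_iff.1 hγ
  have h := hle _ (S.staticReduction_mem (linearFeedback_mem (S.finiteGain T)))
  rw [staticJ, staticJ, expectedCost, expectedCost, ENNReal.div_le_iff_le_mul
    (Or.inl (by exact_mod_cast hT.ne')) (Or.inl (ENNReal.natCast_ne_top T)),
    ENNReal.div_mul_cancel (by exact_mod_cast hT.ne') (ENNReal.natCast_ne_top T),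
    S.lintegral_pathCost_finiteGain hQ hR hζ] at h
  filter_upwards [S.ae_eq_feedback_of_lintegral_le hQ hR hζ
    (S.measurable_staticActions hζ hmem) T h] with ω hω t ht
  -- The law so far refers to the policy's own trajectory; induction on time identifies that
  -- trajectory with the closed-loop one.
  have e1 := S.eq_dynamicActions_of_feedback (S.finiteGain T) _ _ T hω t ht
  rwa [← staticActions_staticReduction] at e1

/-! ### Average-cost optimality. -/

theorem tendsto_riccatiK {n m : ℕ} {S : LQSystem n m} {K : Matrix (Fin n) (Fin n) ℝ}
    (hK : Tendsto (fun N => S.riccatiStep^[N] 0) atTop (𝓝 K)) (t : ℕ) :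
    Tendsto (fun T => S.riccatiK T t) atTop (𝓝 K) :=
  hK.comp (tendsto_sub_atTop_nat t)

/-- Time reversal turns the value into partial sums of one sequence independent of T, as Cesàro
averaging requires; the term t = T is zero. -/
theorem finiteValue_eq {n m : ℕ} (S : LQSystem n m) {Ω : Type*} [MeasurableSpace Ω]
    (P : Measure Ω) (ζ : ℕ → Ω → Fin n → ℝ) (T : ℕ) :
    S.finiteValue P ζ T = ∑ j ∈ Finset.range T, noiseEnergy P ζ (S.riccatiStep^[j + 1] 0) := by
  have h0 : noiseEnergy P ζ (0 : Matrix (Fin n) (Fin n) ℝ) = 0 := by simp [noiseEnergy]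
  rw [finiteValue, ← Finset.sum_range_reflect, Finset.sum_range_succ']
  simp only [riccatiK, Nat.add_sub_cancel, Nat.sub_zero, Nat.sub_self, Function.iterate_zero, id,
    h0, add_zero]
  refine Finset.sum_congr rfl fun j hj => ?_
  have hj := Finset.mem_range.1 hj
  rw [show T - (T - (j + 1)) = j + 1 by omega]

theorem tendsto_finiteValue_div {n m : ℕ} {S : LQSystem n m} {Ω : Type*} [MeasurableSpace Ω]
    {P : Measure Ω} {ζ : ℕ → Ω → Fin n → ℝ} (hζ : IsWhiteNoise P ζ)
    {K : Matrix (Fin n) (Fin n) ℝ}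
    (hK : Tendsto (fun N => S.riccatiStep^[N] 0) atTop (𝓝 K)) :
    Tendsto (fun T : ℕ => ENNReal.ofReal (S.finiteValue P ζ T) / (T : ℝ≥0∞)) atTop
      (𝓝 (ENNReal.ofReal (noiseEnergy P ζ K))) := by
  have h1 : Tendsto (fun j => noiseEnergy P ζ (S.riccatiStep^[j + 1] 0)) atTop
      (𝓝 (noiseEnergy P ζ K)) :=
    ((continuous_noiseEnergy hζ).tendsto K).comp (hK.comp (tendsto_add_atTop_nat 1))
  refine ((ENNReal.continuous_ofReal.tendsto _).comp h1.cesaro).congr' ?_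
  filter_upwards [eventually_gt_atTop 0] with T hT
  have hT' : (0 : ℝ) < T := by exact_mod_cast hT
  rw [Function.comp, ← finiteValue_eq, inv_mul_eq_div, ENNReal.ofReal_div_of_pos hT',
    ENNReal.ofReal_natCast]

theorem ofReal_noiseEnergy_le_staticAvgJ {n m : ℕ} (S : LQSystem n m) (hQ : S.Q.PosSemidef)
    (hR : S.R.PosDef) {Ω : Type*} [MeasurableSpace Ω] {P : Measure Ω} [IsProbabilityMeasure P]
    {ζ : ℕ → Ω → Fin n → ℝ} (hζ : IsWhiteNoise P ζ) {K : Matrix (Fin n) (Fin n) ℝ}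
    (hK : Tendsto (fun N => S.riccatiStep^[N] 0) atTop (𝓝 K)) {γ : TeamPolicy n m}
    (hγ : γ ∈ admissiblePolicies n m) :
    ENNReal.ofReal (noiseEnergy P ζ K) ≤ S.staticAvgJ P ζ γ := by
  rw [← (tendsto_finiteValue_div hζ hK).limsup_eq]
  exact limsup_le_limsup (Eventually.of_forall fun T => ENNReal.div_le_div_right
    (S.ofReal_finiteValue_le hQ hR hζ (S.measurable_staticActions hζ hγ) T) _)

/-- The constant sequence K solves the recursion, the squares vanish under its own gain, and the
terminal term is nonnegative, hence can be dropped. -/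
theorem staticAvgJ_gain_le {n m : ℕ} (S : LQSystem n m) (hQ : S.Q.PosSemidef)
    (hR : S.R.PosDef) {Ω : Type*} [MeasurableSpace Ω] {P : Measure Ω} [IsProbabilityMeasure P]
    {ζ : ℕ → Ω → Fin n → ℝ} (hζ : IsWhiteNoise P ζ) {K : Matrix (Fin n) (Fin n) ℝ}
    (hK : K.PosSemidef) (hfix : S.riccatiStep K = K) :
    S.staticAvgJ P ζ (S.staticReduction (linearFeedback fun _ => S.gain K))
      ≤ ENNReal.ofReal (noiseEnergy P ζ K) := by
  set e := noiseEnergy P ζ K with he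
  -- Here e + e/T = (T+1)e/T: a horizon of T stages meets T + 1 noise vectors, X_0 included.
  have hlim : Tendsto (fun T : ℕ => ENNReal.ofReal (e + e / T)) atTop (𝓝 (ENNReal.ofReal e)) := by
    have h := (tendsto_const_nhds (x := e)).add (tendsto_const_div_atTop_nhds_zero_nat e)
    rw [add_zero] at h
    exact (ENNReal.continuous_ofReal.tendsto _).comp h
  rw [← hlim.limsup_eq]
  refine limsup_le_limsup ?_
  filter_upwards [eventually_gt_atTop 0] with T hT
  have hT' : (0 : ℝ) < T := by exact_mod_cast hT
  have hu := fun t (_ : t < T) => S.memLp_staticActions_linearFeedback hζ (fun _ => S.gain K) t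
  have h := S.integral_pathCost_add_terminal hR hζ
    (S.measurable_staticActions hζ (S.staticReduction_mem (linearFeedback_mem _))) T hu
    (fun _ => K) (fun _ => hK) fun _ _ => hfix.symm
  rw [Finset.sum_eq_zero (s := Finset.range T) fun t _ => by
    simp_rw [← S.staticActions_linearFeedback (fun _ => S.gain K)]; simp, add_zero,
    Finset.sum_const, Finset.card_range, nsmul_eq_mul, ← he] at h
  have hle : ∫ ω, S.pathCost T (fun k => ζ k ω) (S.staticActions
      (S.staticReduction (linearFeedback fun _ => S.gain K)) fun k => ζ k ω) ∂P
      ≤ ((T + 1 : ℕ) : ℝ) * e :=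
    h ▸ le_add_of_nonneg_right (integral_nonneg fun ω => hK.quadForm_nonneg _)
  rw [staticJ, expectedCost, S.lintegral_pathCost hQ hR hζ T hu, ← ENNReal.ofReal_natCast,
    ← ENNReal.ofReal_div_of_pos hT']
  refine ENNReal.ofReal_le_ofReal ?_
  rw [div_le_iff₀ hT', add_mul, div_mul_cancel₀ _ hT'.ne']
  push_cast at hle
  linarith

theorem staticAvgJ_staticReduction {n m : ℕ} (S : LQSystem n m) {Ω : Type*} [MeasurableSpace Ω]
    (P : Measure Ω) (ζ : ℕ → Ω → Fin n → ℝ) (g : TeamPolicy n m) :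
    S.staticAvgJ P ζ (S.staticReduction g) = S.dynamicAvgJ P ζ g := by
  unfold staticAvgJ dynamicAvgJ staticJ expectedCost
  simp only [staticActions_staticReduction]

theorem staticAvgJ_congr_ae {n m : ℕ} (S : LQSystem n m) {Ω : Type*} [MeasurableSpace Ω]
    {P : Measure Ω} {ζ : ℕ → Ω → Fin n → ℝ} {γ γ' : TeamPolicy n m}
    (h : ∀ᵐ ω ∂P, ∀ t, γ t (S.staticInfo (fun k => ζ k ω) t)
      = γ' t (S.staticInfo (fun k => ζ k ω) t)) :
    S.staticAvgJ P ζ γ = S.staticAvgJ P ζ γ' := by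
  have h1 : ∀ T, S.staticJ P ζ T γ = S.staticJ P ζ T γ' := fun T => by
    unfold staticJ expectedCost
    congr 1
    refine lintegral_congr_ae ?_
    filter_upwards [h] with ω hω
    rw [show S.staticActions γ (fun k => ζ k ω) = S.staticActions γ' fun k => ζ k ω from
      funext hω]
  simp only [staticAvgJ, h1]

/-- Linear feedback actions depend continuously on the gains. -/
theorem tendsto_dynamicActions_linearFeedback {n m : ℕ} (S : LQSystem n m)
    {G : ℕ → ℕ → Matrix (Fin m) (Fin n) ℝ} {L : ℕ → Matrix (Fin m) (Fin n) ℝ}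
    (hG : ∀ t, Tendsto (fun T => G T t) atTop (𝓝 (L t))) (z : ℕ → Fin n → ℝ) (t : ℕ) :
    Tendsto (fun T => S.dynamicActions (linearFeedback (G T)) z t) atTop
      (𝓝 (S.dynamicActions (linearFeedback L) z t)) := by
  have hmv : ∀ {p q : ℕ} {M : ℕ → Matrix (Fin p) (Fin q) ℝ} {M₀ : Matrix (Fin p) (Fin q) ℝ}
      {x : ℕ → Fin q → ℝ} {x₀ : Fin q → ℝ}, Tendsto M atTop (𝓝 M₀) → Tendsto x atTop (𝓝 x₀) →
      Tendsto (fun T => M T *ᵥ x T) atTop (𝓝 (M₀ *ᵥ x₀)) := by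
    intro p q M M₀ x x₀ hM hx
    have hc : Continuous fun a : Matrix (Fin p) (Fin q) ℝ × (Fin q → ℝ) => a.1 *ᵥ a.2 :=
      continuous_fst.matrix_mulVec continuous_snd
    exact (hc.tendsto (M₀, x₀)).comp (hM.prodMk_nhds hx)
  have hx : ∀ t, Tendsto
      (fun T => S.state z (S.dynamicActions (linearFeedback (G T)) z) t) atTop
      (𝓝 (S.state z (S.dynamicActions (linearFeedback L) z) t)) := by
    intro t
    induction t with
    | zero => exact tendsto_const_nhds
    | succ t ih =>
      simp only [state]
      refine ((hmv tendsto_const_nhds ih).add (hmv tendsto_const_nhds ?_)).add tendsto_const_nhds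
      simp_rw [dynamicActions_linearFeedback _ _ z t]
      exact hmv (hG t) ih
  simp_rw [dynamicActions_linearFeedback _ _ z t]
  exact hmv (hG t) (hx t)

end LQSystem

/-! ### The main theorem. -/

theorem mainTheorem12 {n m : ℕ} (S : LQSystem n m)
    (hctrl : S.Controllable) (hQ : S.Q.PosSemidef) (hR : S.R.PosDef)
    {Ω : Type*} [MeasurableSpace Ω] (P : Measure Ω) [IsProbabilityMeasure P]
    (ζ : ℕ → Ω → Fin n → ℝ) (hmeas : ∀ k, Measurable (ζ k))
    (hindep : iIndepFun ζ P) (hident : ∀ k, IdentDistrib (ζ k) (ζ 0) P P)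
    (hgauss : ∀ k, HasGaussianLaw (ζ k) P) (hmean : ∀ k, ∫ ω, ζ k ω ∂P = 0) :
    ∃ K : Matrix (Fin n) (Fin n) ℝ,
      -- the Riccati matrices converge to a positive semidefinite solution of the Riccati equation
      K.PosSemidef ∧ S.riccatiStep K = K ∧
      (∀ t, Tendsto (fun T => S.riccatiK T t) atTop (𝓝 K)) ∧
      (∀ t, Tendsto (fun T => S.finiteGain T t) atTop (𝓝 (S.gain K))) ∧
      -- the Riccati feedback `u^t = G_T^t X_t` is optimal for every finite horizon
      (∀ T, IsTeamOptimal (admissiblePolicies n m) (S.staticJ P ζ T)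
        (S.staticReduction (LQSystem.linearFeedback (S.finiteGain T)))) ∧
      -- these policies converge pointwise to the policy that realizes `u^t = G_∞ X_t`
      (∀ t v, Tendsto
        (fun T => S.staticReduction (LQSystem.linearFeedback (S.finiteGain T)) t v) atTop
        (𝓝 (S.staticReduction (LQSystem.linearFeedback fun _ => S.gain K) t v))) ∧
      (∀ z t, S.staticActions (S.staticReduction (LQSystem.linearFeedback fun _ => S.gain K)) z t
        = S.gain K *ᵥ S.state z
            (S.staticActions (S.staticReduction (LQSystem.linearFeedback fun _ => S.gain K)) z)
            t) ∧
      -- this limit policy is optimal for the average cost, which is finite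
      IsTeamOptimal (admissiblePolicies n m) (S.staticAvgJ P ζ)
        (S.staticReduction (LQSystem.linearFeedback fun _ => S.gain K)) ∧
      S.staticAvgJ P ζ (S.staticReduction (LQSystem.linearFeedback fun _ => S.gain K)) < ⊤ ∧
      -- the same for the original dynamic team
      IsTeamOptimal (admissiblePolicies n m) (S.dynamicAvgJ P ζ)
        (LQSystem.linearFeedback fun _ => S.gain K) ∧
      -- any sequence of finite-horizon optimal policies has this pointwise limit, almost surely,
      -- and each of its pointwise limits is optimal for the average cost
      (∀ γ : ℕ → TeamPolicy n m,
        (∀ T, IsTeamOptimal (admissiblePolicies n m) (S.staticJ P ζ T) (γ T)) →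
        (∀ᵐ ω ∂P, ∀ t, Tendsto (fun T => γ T t (S.staticInfo (fun k => ζ k ω) t)) atTop
          (𝓝 (S.staticReduction (LQSystem.linearFeedback fun _ => S.gain K) t
            (S.staticInfo (fun k => ζ k ω) t)))) ∧
        ∀ γlim ∈ admissiblePolicies n m,
          (∀ᵐ ω ∂P, ∀ t, Tendsto (fun T => γ T t (S.staticInfo (fun k => ζ k ω) t)) atTop
            (𝓝 (γlim t (S.staticInfo (fun k => ζ k ω) t)))) →
          IsTeamOptimal (admissiblePolicies n m) (S.staticAvgJ P ζ) γlim) := by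
  -- Gaussianity enters through square integrability.
  have hζ : IsWhiteNoise P ζ := ⟨hmeas, hindep, hident, fun k => (hgauss k).memLp_two, hmean⟩
  obtain ⟨K, hK⟩ := S.exists_tendsto_riccati hctrl hQ hR
  have hKpos : K.PosSemidef :=
    LQSystem.posSemidef_of_tendsto (fun N => S.posSemidef_riccatiK hQ hR N 0) hK
  have hfix : S.riccatiStep K = K := by
    -- The shifted iterates converge both to K and, by continuity, to the Riccati step of K.
    refine tendsto_nhds_unique ((S.continuousAt_riccatiStep hR hKpos).tendsto.comp hK) ?_
    refine (hK.comp (tendsto_add_atTop_nat 1)).congr fun N => ?_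
    exact Function.iterate_succ_apply' S.riccatiStep N 0
  have hgain : ∀ t, Tendsto (fun T => S.finiteGain T t) atTop (𝓝 (S.gain K)) := fun t =>
    (S.continuousAt_gain hR hKpos).tendsto.comp (LQSystem.tendsto_riccatiK hK (t + 1))
  have hpol : ∀ t v, Tendsto
      (fun T => S.staticReduction (LQSystem.linearFeedback (S.finiteGain T)) t v) atTop
      (𝓝 (S.staticReduction (LQSystem.linearFeedback fun _ => S.gain K) t v)) := fun t v =>
    S.tendsto_dynamicActions_linearFeedback hgain (S.noiseOf v) t
  have hlow := fun (γ : TeamPolicy n m) (hγ : γ ∈ admissiblePolicies n m) =>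
    S.ofReal_noiseEnergy_le_staticAvgJ hQ hR hζ hK hγ
  have hup := S.staticAvgJ_gain_le hQ hR hζ hKpos hfix
  have hopt : IsTeamOptimal (admissiblePolicies n m) (S.staticAvgJ P ζ)
      (S.staticReduction (LQSystem.linearFeedback fun _ => S.gain K)) :=
    isTeamOptimal_iff.2 ⟨S.staticReduction_mem (LQSystem.linearFeedback_mem _),
      fun γ hγ => hup.trans (hlow γ hγ)⟩
  refine ⟨K, hKpos, hfix, LQSystem.tendsto_riccatiK hK, hgain,
    S.isTeamOptimal_staticJ_finiteGain hQ hR hζ, hpol,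
    S.staticActions_linearFeedback _, hopt, hup.trans_lt ENNReal.ofReal_lt_top, ?_, ?_⟩
  · refine isTeamOptimal_iff.2 ⟨LQSystem.linearFeedback_mem _, fun g hg => ?_⟩
    -- A dynamic policy costs as much as its static reduction, so the static lower bound applies.
    rw [← S.staticAvgJ_staticReduction, ← S.staticAvgJ_staticReduction]
    exact hup.trans (hlow _ (S.staticReduction_mem hg))
  · intro γ hγ
    have hlim : ∀ᵐ ω ∂P, ∀ t, Tendsto (fun T => γ T t (S.staticInfo (fun k => ζ k ω) t)) atTop
        (𝓝 (S.staticReduction (LQSystem.linearFeedback fun _ => S.gain K) t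
          (S.staticInfo (fun k => ζ k ω) t))) := by
      filter_upwards [ae_all_iff.2 fun T => S.ae_eq_of_isTeamOptimal_staticJ hQ hR hζ (hγ T)]
        with ω hω t
      refine (hpol t _).congr' ?_
      -- Optimality for horizon T determines only the actions at times t < T.
      filter_upwards [eventually_gt_atTop t] with T hT
      exact (hω T t hT).symm
    refine ⟨hlim, fun γlim hmem hconv => isTeamOptimal_iff.2 ⟨hmem, fun γ' hγ' => ?_⟩⟩
    have hae : ∀ᵐ ω ∂P, ∀ t, γlim t (S.staticInfo (fun k => ζ k ω) t)
        = S.staticReduction (LQSystem.linearFeedback fun _ => S.gain K) t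
          (S.staticInfo (fun k => ζ k ω) t) := by
      filter_upwards [hlim, hconv] with ω h1 h2 t
      exact tendsto_nhds_unique (h2 t) (h1 t)
    rw [S.staticAvgJ_congr_ae hae]
    exact hup.trans (hlow γ' hγ')
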